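/- Let $\mathcal H$ be a finite-dimensional complex Hilbert space, let $\rho$ be a density operator on $\mathcal H$ (positive semidefinite, trace one, not necessarily invertible) and let $\delta$ be a tangent vector at $\rho$, i.e. a Hermitian operator on $\mathcal H$ with $\mathrm{tr}\,\delta=0$. For $n\ge 1$ put $$\delta^{(n)}:=\delta\otimes\rho^{\otimes (n-1)}+\rho\otimes\delta\otimes\rho^{\otimes (n-2)}+\cdots+\rho^{\otimes (n-1)}\otimes\delta .$$ For a density operator $\sigma$ and a Hermitian traceless operator $\eta$ on a finite-dimensional space, the SLD Fisher information is $J^S_\sigma(\eta):=\mathrm{tr}\,\sigma L^2$, where $L=L^\dagger$ solves $\eta=\tfrac12(L\sigma+\sigma L)$, and the RLD Fisher information is $J^R_\sigma(\eta):=\Re\,\mathrm{tr}\,\sigma L^\dagger L$, where $L$ solves $\eta=L\sigma$. The values do not depend on the choice of the solution $L$, and they are $+\infty$ if the respective equation has no solution. Theorem ($J^S$ and $J^R$ satisfy (C)). For each $n$ let $\rho'^n$ be a density operator and $\delta'^n$ a Hermitian traceless operator on $\mathcal H^{\otimes n}$, such that $$\left\Vert \rho'^n-\rho^{\otimes n}\right\Vert_1\to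 0\quad\text{and}\quad \frac1{\sqrt n}\left\Vert \delta'^n-\delta^{(n)}\right\Vert_1\to 0\qquad(n\to\infty),$$ where $\|\cdot\|_1$ is the trace norm. If $J^S_\rho(\delta)<\infty$, then $$\varliminf_{n\to\infty}\frac1n\left(J^S_{\rho'^n}(\delta'^n)-J^S_{\rho^{\otimes n}}(\delta^{(n)})\right)\ge 0 ,$$ and if $J^R_\rho(\delta)<\infty$, then $$\varliminf_{n\to\infty}\frac1n\left(J^R_{\rho'^n}(\delta'^n)-J^R_{\rho^{\otimes n}}(\delta^{(n)})\right)\ge 0 .$$ (The differences are taken in $(-\infty,+\infty]$.) -/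

import Mathlib

open scoped Matrix ComplexOrder

namespace QFisher

noncomputable section

/-- Density operators on the finite-dimensional Hilbert space with orthonormal basis `d`. -/
def IsDensity {d : Type*} [Fintype d] (ρ : Matrix d d ℂ) : Prop :=
  ρ.PosSemidef ∧ ρ.trace = 1

/-- Tangent vectors to the set of density operators: Hermitian operators of trace zero. -/
def IsTangent {d : Type*} [Fintype d] (δ : Matrix d d ℂ) : Prop :=
  δ.IsHermitian ∧ δ.trace = 0

/-- The trace norm `‖A‖₁ = tr √(A†A)`, that is, the sum of the singular values of `A`. -/
def traceNorm {d : Type*} [Fintype d] [DecidableEq d] (A : Matrix d d ℂ) : ℝ :=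
  ∑ i, √((Matrix.isHermitian_conjTranspose_mul_self A).eigenvalues i)

/-- The tensor product `A 0 ⊗ A 1 ⊗ ⋯ ⊗ A (n - 1)`, in the product basis `Fin n → d`. -/
def tensorProd {d : Type*} {n : ℕ} (A : Fin n → Matrix d d ℂ) :
    Matrix (Fin n → d) (Fin n → d) ℂ :=
  Matrix.of fun x y => ∏ i, A i (x i) (y i)

/-- `ρ^{⊗ n}`. -/
def tensorPow {d : Type*} (ρ : Matrix d d ℂ) (n : ℕ) : Matrix (Fin n → d) (Fin n → d) ℂ :=
  tensorProd fun _ => ρ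

/-- `δ^{(n)} = δ ⊗ ρ ⊗ ⋯ ⊗ ρ + ρ ⊗ δ ⊗ ρ ⊗ ⋯ ⊗ ρ + ⋯ + ρ ⊗ ⋯ ⊗ ρ ⊗ δ` (`n` summands). -/
def tangentPow {d : Type*} (ρ δ : Matrix d d ℂ) (n : ℕ) :
    Matrix (Fin n → d) (Fin n → d) ℂ :=
  ∑ k : Fin n, tensorProd fun i => if i = k then δ else ρ

/-- `L` is a symmetric logarithmic derivative of `δ` at `ρ`. -/
def IsSLD {d : Type*} [Fintype d] (ρ δ L : Matrix d d ℂ) : Prop :=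
  L.IsHermitian ∧ δ = (1 / 2 : ℂ) • (L * ρ + ρ * L)

/-- `L` is a right logarithmic derivative of `δ` at `ρ`. -/
def IsRLD {d : Type*} [Fintype d] (ρ δ L : Matrix d d ℂ) : Prop :=
  δ = L * ρ

/-- The SLD Fisher information `tr ρ L²`, where `L` is an SLD; it is `⊤` if there is none.
By `sldFisher_eq` the value does not depend on the choice of `L`. -/
def sldFisher {d : Type*} [Fintype d] (ρ δ : Matrix d d ℂ) : EReal :=
  ⨅ (L : Matrix d d ℂ) (_ : IsSLD ρ δ L), (((ρ * (L * L)).trace.re : ℝ) : EReal)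

/-- The RLD Fisher information `Re tr ρ L†L`, where `L` is an RLD; it is `⊤` if there is none.
By `rldFisher_eq` the value does not depend on the choice of `L`. -/
def rldFisher {d : Type*} [Fintype d] (ρ δ : Matrix d d ℂ) : EReal :=
  ⨅ (L : Matrix d d ℂ) (_ : IsRLD ρ δ L), (((ρ * (Lᴴ * L)).trace.re : ℝ) : EReal)

theorem IsSLD.trace_eq {d : Type*} [Fintype d] {ρ δ L K : Matrix d d ℂ}
    (hL : IsSLD ρ δ L) (hK : IsSLD ρ δ K) :
    (ρ * (L * L)).trace = (ρ * (K * K)).trace := by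
  have key : ∀ A B : Matrix d d ℂ, IsSLD ρ δ A →
      (δ * B).trace = (1 / 2 : ℂ) * ((ρ * (B * A)).trace + (ρ * (A * B)).trace) := by
    intro A B hA
    rw [hA.2, Matrix.smul_mul, Matrix.trace_smul, smul_eq_mul, add_mul, Matrix.trace_add,
      Matrix.mul_assoc, Matrix.trace_mul_comm A, Matrix.mul_assoc, Matrix.mul_assoc]
  have h1 := key L L hL
  have h2 := key L K hL
  have h3 := key K L hK
  have h4 := key K K hK
  linear_combination h3 - h1 + h4 - h2

theorem IsRLD.trace_eq {d : Type*} [Fintype d] {ρ δ L K : Matrix d d ℂ} (hρ : ρ.IsHermitian)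
    (hL : IsRLD ρ δ L) (hK : IsRLD ρ δ K) :
    (ρ * (Lᴴ * L)).trace.re = (ρ * (Kᴴ * K)).trace.re := by
  have h : L * ρ = K * ρ := hL.symm.trans hK
  have h' : ρ * Lᴴ = ρ * Kᴴ := by
    have := congrArg Matrix.conjTranspose h
    simpa [Matrix.conjTranspose_mul, hρ.eq] using this
  rw [← Matrix.mul_assoc, h', Matrix.mul_assoc, ← Matrix.trace_mul_comm, Matrix.mul_assoc, h,
    ← Matrix.mul_assoc, Matrix.mul_assoc, Matrix.trace_mul_comm, Matrix.mul_assoc,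
    Matrix.trace_mul_comm, Matrix.mul_assoc]

theorem sldFisher_eq {d : Type*} [Fintype d] {ρ δ L : Matrix d d ℂ} (hL : IsSLD ρ δ L) :
    sldFisher ρ δ = (((ρ * (L * L)).trace.re : ℝ) : EReal) :=
  le_antisymm (iInf₂_le L hL) (le_iInf₂ fun K hK => by rw [hL.trace_eq hK])

theorem rldFisher_eq {d : Type*} [Fintype d] {ρ δ L : Matrix d d ℂ} (hρ : ρ.IsHermitian)
    (hL : IsRLD ρ δ L) :
    rldFisher ρ δ = (((ρ * (Lᴴ * L)).trace.re : ℝ) : EReal) :=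
  le_antisymm (iInf₂_le L hL) (le_iInf₂ fun K hK => by rw [IsRLD.trace_eq hρ hL hK])

end

end QFisher

/-!
Each of the two Fisher informations is a supremum of affine functions of the pair `(σ, η)`: for
every `X` (Hermitian in the SLD case),
`J_σ(η) ≥ 2 Re tr(η X†) - Re tr(σ X†X)`,
and if `L` is a logarithmic derivative, the right side is `J_σ(η) - Re tr(σ (L - X)†(L - X))`
(`IsSLD.re_trace_mul`, `IsRLD.re_trace_mul`). By the duality of trace norm and operator norm
(`norm_trace_mul_le`), an `X` with `‖X‖ ≤ a` therefore yields at a nearby pair `(σ', η')` the bound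
`J_σ'(η') ≥ J_σ(η) - 2 a ‖η' - η‖₁ - a² ‖σ' - σ‖₁ - Re tr(σ (L - X)†(L - X))`
(`le_sldFisher_of_near`, `le_rldFisher_of_near`).

A logarithmic derivative of `δ^{(n)}` at `ρ^{⊗n}` is the sum `S` of the `n` one-site copies of one
of `δ` at `ρ`, which is `tangentPow 1 L n`. Its norm is of order `n`, too large for the assumed rate
of convergence, but in the state `ρ^{⊗n}` it is typically of order `√n`, because `tr(ρ L) = tr δ = 0`.
So `X` is taken to be `S` truncated at `a = C √n`. For Hermitian `L`, an eigenbasis of `L` turns `S`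
into a sum of `n` independent centred random variables, and since its fourth moment is at most
`K n²`, the truncation error is at most `K n² / a² = (K / C²) n`
(`exists_truncation_of_isHermitian`); a general `L` is split into its real and imaginary parts
(`exists_truncation`). After division by `n` the lower limit is at least `-K / C²`, and `C` is
arbitrary (`liminf_nonneg_of_lower_bound`).
-/

namespace QFisher

open Matrix

/-! ### Tensor powers and sums of one-site copies -/

section TensorAlgebra

variable {d : Type*} {n : ℕ}

theorem tensorProd_mul [Fintype d] (A B : Fin n → Matrix d d ℂ) :
    tensorProd A * tensorProd B = tensorProd fun i => A i * B i := by
  classical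
  ext x y
  simp only [tensorProd, Matrix.mul_apply, Matrix.of_apply, ← Finset.prod_mul_distrib]
  rw [Finset.prod_univ_sum, Fintype.piFinset_univ]

theorem tensorProd_conjTranspose (A : Fin n → Matrix d d ℂ) :
    (tensorProd A)ᴴ = tensorProd fun i => (A i)ᴴ := by
  ext x y
  simp [tensorProd, Matrix.conjTranspose_apply]

theorem tensorPow_mul [Fintype d] (A B : Matrix d d ℂ) :
    tensorPow A n * tensorPow B n = tensorPow (A * B) n :=
  tensorProd_mul _ _

theorem tensorPow_conjTranspose (A : Matrix d d ℂ) : (tensorPow A n)ᴴ = tensorPow Aᴴ n :=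
  tensorProd_conjTranspose _

theorem tensorPow_one [DecidableEq d] : tensorPow (1 : Matrix d d ℂ) n = 1 := by
  ext x y
  simp only [tensorPow, tensorProd, Matrix.of_apply, Matrix.one_apply, Finset.prod_ite_zero,
    Finset.prod_const_one, Finset.mem_univ, true_implies, funext_iff]

open scoped Matrix.Norms.L2Operator MatrixOrder in
theorem tensorPow_posSemidef [Fintype d] {ρ : Matrix d d ℂ} (hρ : ρ.PosSemidef) :
    (tensorPow ρ n).PosSemidef := by
  classical
  obtain ⟨B, hB⟩ : ∃ B : Matrix d d ℂ, ρ = Bᴴ * B :=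
    CStarAlgebra.nonneg_iff_eq_star_mul_self.mp hρ.nonneg
  rw [hB, ← tensorPow_mul, ← tensorPow_conjTranspose]
  exact Matrix.posSemidef_conjTranspose_mul_self _

theorem tangentPow_mul_tensorPow [Fintype d] (σ L ρ : Matrix d d ℂ) :
    tangentPow σ L n * tensorPow ρ n = tangentPow (σ * ρ) (L * ρ) n := by
  simp only [tangentPow, tensorPow, Finset.sum_mul, tensorProd_mul, ite_mul]

theorem tensorPow_mul_tangentPow [Fintype d] (σ L ρ : Matrix d d ℂ) :
    tensorPow ρ n * tangentPow σ L n = tangentPow (ρ * σ) (ρ * L) n := by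
  simp only [tangentPow, tensorPow, Finset.mul_sum, tensorProd_mul, mul_ite]

theorem tangentPow_conjTranspose (ρ δ : Matrix d d ℂ) :
    (tangentPow ρ δ n)ᴴ = tangentPow ρᴴ δᴴ n := by
  simp only [tangentPow, Matrix.conjTranspose_sum, tensorProd_conjTranspose,
    apply_ite Matrix.conjTranspose]

theorem tangentPow_apply (ρ δ : Matrix d d ℂ) (x y : Fin n → d) :
    tangentPow ρ δ n x y =
      ∑ k, δ (x k) (y k) * ∏ i ∈ Finset.univ.erase k, ρ (x i) (y i) := by
  simp only [tangentPow, Matrix.sum_apply, tensorProd, Matrix.of_apply]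
  refine Finset.sum_congr rfl fun k _ => ?_
  rw [← Finset.mul_prod_erase _ _ (Finset.mem_univ k), if_pos rfl]
  congr 1
  exact Finset.prod_congr rfl fun i hi => by rw [if_neg (Finset.ne_of_mem_erase hi)]

theorem tangentPow_add (ρ A B : Matrix d d ℂ) :
    tangentPow ρ (A + B) n = tangentPow ρ A n + tangentPow ρ B n := by
  ext x y
  simp only [tangentPow_apply, Matrix.add_apply, add_mul, Finset.sum_add_distrib]

theorem tangentPow_smul (ρ A : Matrix d d ℂ) (c : ℂ) :
    tangentPow ρ (c • A) n = c • tangentPow ρ A n := by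
  ext x y
  simp only [tangentPow_apply, Matrix.smul_apply, smul_eq_mul, mul_assoc, Finset.mul_sum]

theorem tangentPow_one_diagonal [DecidableEq d] (e : d → ℂ) :
    tangentPow 1 (Matrix.diagonal e) n = Matrix.diagonal fun x => ∑ i, e (x i) := by
  ext x y
  rw [tangentPow_apply]
  by_cases h : x = y
  · subst h
    simp
  · rw [Matrix.diagonal_apply_ne _ h]
    obtain ⟨j, hj⟩ := Function.ne_iff.mp h
    refine Finset.sum_eq_zero fun k _ => ?_
    by_cases hk : k = j
    · subst hk
      rw [Matrix.diagonal_apply_ne _ hj, zero_mul]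
    · exact mul_eq_zero_of_right _ (Finset.prod_eq_zero
        (Finset.mem_erase.mpr ⟨Ne.symm hk, Finset.mem_univ j⟩) (Matrix.one_apply_ne hj))

/-- The sum of the one-site copies of a logarithmic derivative is a logarithmic derivative of
the product model. -/
theorem IsSLD.tensor [Fintype d] [DecidableEq d] {ρ δ L : Matrix d d ℂ} (h : IsSLD ρ δ L) :
    IsSLD (tensorPow ρ n) (tangentPow ρ δ n) (tangentPow 1 L n) := by
  refine ⟨?_, ?_⟩
  · rw [Matrix.IsHermitian, tangentPow_conjTranspose, h.1.eq, Matrix.conjTranspose_one]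
  · rw [tangentPow_mul_tensorPow, tensorPow_mul_tangentPow, one_mul, mul_one, ← tangentPow_add,
      ← tangentPow_smul, ← h.2]

theorem IsRLD.tensor [Fintype d] [DecidableEq d] {ρ δ L : Matrix d d ℂ} (h : IsRLD ρ δ L) :
    IsRLD (tensorPow ρ n) (tangentPow ρ δ n) (tangentPow 1 L n) := by
  rw [IsRLD, tangentPow_mul_tensorPow, one_mul, ← show δ = L * ρ from h]

end TensorAlgebra

/-! ### Fourth moment of a sum of independent centred variables -/

section FourthMoment

variable {d : Type*} [Fintype d] (p e : d → ℝ)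

/-- The `k`-th moment of `e (x 0) + ⋯ + e (x (n - 1))` for independent `x i` with weights `p`,
as a finite sum; nothing is normalised here, and `∑ c, p c = 1` is assumed where it is needed. -/
def sumMoment (n k : ℕ) : ℝ :=
  ∑ x : Fin n → d, (∏ i, p (x i)) * (∑ i, e (x i)) ^ k

/-- Conditioning on the value `c` of the first variable. -/
theorem sumMoment_succ (n k : ℕ) :
    sumMoment p e (n + 1) k =
      ∑ c : d, p c * ∑ x : Fin n → d, (∏ i, p (x i)) * (e c + ∑ i, e (x i)) ^ k := by
  rw [sumMoment, ← (Fin.consEquiv fun _ => d).sum_comp, Fintype.sum_prod_type]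
  refine Finset.sum_congr rfl fun c _ => ?_
  rw [Finset.mul_sum]
  refine Finset.sum_congr rfl fun x _ => ?_
  simp only [Fin.consEquiv_apply, Fin.prod_univ_succ, Fin.sum_univ_succ, Fin.cons_zero,
    Fin.cons_succ, mul_assoc]

variable {p e}

theorem sumMoment_zero_right (hp : ∑ c, p c = 1) (n : ℕ) : sumMoment p e n 0 = 1 := by
  induction n with
  | zero => simp [sumMoment]
  | succ n ih =>
    rw [sumMoment_succ]
    simp only [sumMoment, pow_zero] at ih ⊢
    rw [ih]
    simpa using hp

theorem sumMoment_one_right (hp : ∑ c, p c = 1) (he : ∑ c, p c * e c = 0) (n : ℕ) :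
    sumMoment p e n 1 = 0 := by
  induction n with
  | zero => simp [sumMoment]
  | succ n ih =>
    have h0 := sumMoment_zero_right (e := e) hp n
    rw [sumMoment_succ]
    have : ∀ c, ∑ x : Fin n → d, (∏ i, p (x i)) * (e c + ∑ i, e (x i)) ^ 1 =
        e c * sumMoment p e n 0 + sumMoment p e n 1 := fun c => by
      simp only [sumMoment, Finset.mul_sum, ← Finset.sum_add_distrib]
      exact Finset.sum_congr rfl fun x _ => by ring
    simp only [this, h0, ih, mul_one, add_zero, he]

theorem sumMoment_two_right (hp : ∑ c, p c = 1) (he : ∑ c, p c * e c = 0) (n : ℕ) :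
    sumMoment p e n 2 = n * ∑ c, p c * e c ^ 2 := by
  induction n with
  | zero => simp [sumMoment]
  | succ n ih =>
    have h0 := sumMoment_zero_right (e := e) hp n
    have h1 := sumMoment_one_right hp he n
    rw [sumMoment_succ]
    have : ∀ c, ∑ x : Fin n → d, (∏ i, p (x i)) * (e c + ∑ i, e (x i)) ^ 2 =
        e c ^ 2 * sumMoment p e n 0 + 2 * e c * sumMoment p e n 1 + sumMoment p e n 2 := fun c => by
      simp only [sumMoment, Finset.mul_sum, ← Finset.sum_add_distrib]
      exact Finset.sum_congr rfl fun x _ => by ring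
    simp only [this, h0, h1, mul_one, mul_zero, add_zero, mul_add, Finset.sum_add_distrib,
      ← Finset.sum_mul, hp, ih]
    push_cast
    ring

theorem sumMoment_four_succ (hp : ∑ c, p c = 1) (he : ∑ c, p c * e c = 0) (n : ℕ) :
    sumMoment p e (n + 1) 4 = sumMoment p e n 4 + 6 * n * (∑ c, p c * e c ^ 2) ^ 2 +
      ∑ c, p c * e c ^ 4 := by
  have h0 := sumMoment_zero_right (e := e) hp n
  have h1 := sumMoment_one_right hp he n
  have h2 := sumMoment_two_right hp he n
  rw [sumMoment_succ]
  have : ∀ c, p c * ∑ x : Fin n → d, (∏ i, p (x i)) * (e c + ∑ i, e (x i)) ^ 4 =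
      p c * e c ^ 4 * sumMoment p e n 0 + 4 * (p c * e c ^ 3) * sumMoment p e n 1 +
        6 * sumMoment p e n 2 * (p c * e c ^ 2) + 4 * sumMoment p e n 3 * (p c * e c) +
        p c * sumMoment p e n 4 := fun c => by
    simp only [sumMoment, Finset.mul_sum, Finset.sum_mul, ← Finset.sum_add_distrib]
    exact Finset.sum_congr rfl fun x _ => by ring
  simp only [this, h0, h1, mul_one, mul_zero, add_zero, Finset.sum_add_distrib,
    ← Finset.mul_sum, ← Finset.sum_mul, hp, he, h2]
  ring

/-- For centred variables only pairings of the indices contribute to the fourth moment at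
leading order, so it grows like `n ^ 2`, not `n ^ 4`. -/
theorem sumMoment_four_le (hp0 : ∀ c, 0 ≤ p c) (hp : ∑ c, p c = 1) (he : ∑ c, p c * e c = 0)
    (n : ℕ) :
    sumMoment p e n 4 ≤
      (3 * (∑ c, p c * e c ^ 2) ^ 2 + ∑ c, p c * e c ^ 4) * (n : ℝ) ^ 2 := by
  have h4 : 0 ≤ ∑ c, p c * e c ^ 4 :=
    Finset.sum_nonneg fun c _ => mul_nonneg (hp0 c) (by positivity)
  induction n with
  | zero => simp [sumMoment]
  | succ n ih =>
    rw [sumMoment_four_succ hp he]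
    -- `6 n v² + m ≤ (3 v² + m) (2 n + 1)`, with `v` the variance and `m` the fourth moment
    have := mul_nonneg h4 n.cast_nonneg
    push_cast
    nlinarith [sq_nonneg (∑ c, p c * e c ^ 2)]

end FourthMoment

/-! ### Truncated sums of one-site observables -/

section Truncation

open scoped Matrix.Norms.L2Operator

/-- Truncation of a real number to the interval `[-a, a]`. -/
def clip (a t : ℝ) : ℝ := max (-a) (min a t)

theorem abs_clip_le {a : ℝ} (ha : 0 < a) (t : ℝ) : |clip a t| ≤ a := by
  rw [clip, abs_le]
  exact ⟨le_max_left _ _, max_le (by linarith) (min_le_left _ _)⟩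

theorem sub_clip_sq_le {a : ℝ} (ha : 0 < a) (t : ℝ) : (t - clip a t) ^ 2 ≤ t ^ 4 / a ^ 2 := by
  rw [le_div_iff₀ (by positivity)]
  rcases le_total a t with h | h
  · rw [clip, min_eq_left h, max_eq_right (by linarith), ← mul_pow,
      show t ^ 4 = (t * t) ^ 2 by ring]
    exact pow_le_pow_left₀ (by nlinarith) (by nlinarith) 2
  · rcases le_total (-a) t with h' | h'
    · rw [clip, min_eq_right h, max_eq_right h', sub_self, zero_pow two_ne_zero, zero_mul]
      exact (even_two_mul 2).pow_nonneg t
    · rw [clip, min_eq_right h, max_eq_left h', ← mul_pow,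
        show t ^ 4 = (t * t) ^ 2 by ring, ← neg_sq]
      exact pow_le_pow_left₀ (by nlinarith) (by nlinarith) 2

/-- Duality of the trace norm and the operator norm. -/
theorem norm_trace_mul_le {m : Type*} [Fintype m] [DecidableEq m] (M X : Matrix m m ℂ) :
    ‖(M * X).trace‖ ≤ ‖X‖ * traceNorm M := by
  set h := Matrix.isHermitian_conjTranspose_mul_self M
  set b := h.eigenvectorBasis
  have htr : (M * X).trace = ∑ i, inner ℂ (b i) (Matrix.toEuclideanLin (X * M) (b i)) := by
    rw [Matrix.trace_mul_comm, ← LinearMap.trace_eq_sum_inner _ b, ← Matrix.trace_toLin'_eq]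
    exact (LinearMap.trace_conj' (Matrix.toLin' (X * M))
      (WithLp.linearEquiv 2 ℂ (m → ℂ)).symm).symm
  rw [htr, traceNorm, Finset.mul_sum]
  refine (norm_sum_le _ _).trans (Finset.sum_le_sum fun i _ => ?_)
  -- the singular values of `M` are the lengths of the images of the eigenvectors of `M†M`
  have hM : ‖Matrix.toEuclideanLin M (b i)‖ = √(h.eigenvalues i) := by
    rw [norm_eq_sqrt_re_inner (𝕜 := ℂ), h.eigenvalues_eq, EuclideanSpace.inner_eq_star_dotProduct,
      Matrix.ofLp_toLpLin, Matrix.toLin'_apply, Matrix.star_mulVec, dotProduct_comm,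
      ← Matrix.dotProduct_mulVec, Matrix.mulVec_mulVec]
  calc ‖inner ℂ (b i) (Matrix.toEuclideanLin (X * M) (b i))‖
      ≤ ‖b i‖ * ‖Matrix.toEuclideanLin (X * M) (b i)‖ := norm_inner_le_norm _ _
    _ = ‖Matrix.toEuclideanLin X (Matrix.toEuclideanLin M (b i))‖ := by
        rw [b.orthonormal.1 i, one_mul]
        simp [Matrix.toLpLin_apply, Matrix.mulVec_mulVec]
    _ ≤ ‖X‖ * √(h.eigenvalues i) := by
        rw [← hM]
        exact Matrix.l2_opNorm_mulVec X _

/-- In an eigenbasis of `A`, the sum of the copies of `A` becomes, for the weights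
`p c = ⟨u_c, ρ u_c⟩`, a sum of independent centred variables, to which truncation and the
fourth-moment bound apply. -/
theorem exists_truncation_of_isHermitian {d : Type*} [Fintype d] [DecidableEq d]
    {ρ A : Matrix d d ℂ} (hρ : IsDensity ρ) (hA : A.IsHermitian) (h0 : (ρ * A).trace = 0) :
    ∃ K : ℝ, 0 ≤ K ∧ ∀ (n : ℕ) (a : ℝ), 0 < a →
      ∃ X : Matrix (Fin n → d) (Fin n → d) ℂ, X.IsHermitian ∧ ‖X‖ ≤ a ∧
        (tensorPow ρ n * ((tangentPow 1 A n - X) * (tangentPow 1 A n - X))).trace.re ≤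
          K * (n : ℝ) ^ 2 / a ^ 2 := by
  set U : Matrix d d ℂ := (hA.eigenvectorUnitary : Matrix d d ℂ)
  set e : d → ℝ := hA.eigenvalues
  have hUU : Uᴴ * U = 1 := Unitary.coe_star_mul_self hA.eigenvectorUnitary
  have hUU' : U * Uᴴ = 1 := Unitary.coe_mul_star_self hA.eigenvectorUnitary
  have hspec : A = U * Matrix.diagonal (fun c => (e c : ℂ)) * Uᴴ := hA.spectral_theorem
  have hpsd : (Uᴴ * ρ * U).PosSemidef := hρ.1.conjTranspose_mul_mul_same U
  set p : d → ℝ := fun c => ((Uᴴ * ρ * U) c c).re with hp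
  have hpC : ∀ c, (Uᴴ * ρ * U) c c = (p c : ℂ) := fun c => by
    have := (Complex.nonneg_iff.mp (hpsd.diag_nonneg (i := c))).2
    exact Complex.ext rfl (by simpa using this.symm)
  have hp0 : ∀ c, 0 ≤ p c := fun c => (Complex.nonneg_iff.mp (hpsd.diag_nonneg (i := c))).1
  have hp1 : ∑ c, p c = 1 := by
    have : (Uᴴ * ρ * U).trace = 1 := by
      rw [Matrix.trace_mul_cycle, hUU', one_mul, hρ.2]
    simp only [Matrix.trace, Matrix.diag_apply, hpC] at this
    exact_mod_cast this
  have hpe : ∑ c, p c * e c = 0 := by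
    have : (Uᴴ * ρ * U * Matrix.diagonal (fun c => (e c : ℂ))).trace = 0 := by
      rw [← h0, hspec, Matrix.mul_assoc, Matrix.mul_assoc, Matrix.trace_mul_comm,
        Matrix.mul_assoc, Matrix.mul_assoc]
    simp only [Matrix.trace, Matrix.diag_apply, Matrix.mul_diagonal, hpC] at this
    exact_mod_cast this
  refine ⟨3 * (∑ c, p c * e c ^ 2) ^ 2 + ∑ c, p c * e c ^ 4, ?_, fun n a ha => ?_⟩
  · have : 0 ≤ ∑ c, p c * e c ^ 4 :=
      Finset.sum_nonneg fun c _ => mul_nonneg (hp0 c) (by positivity)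
    positivity
  set V := tensorPow U n with hV
  have hVV : Vᴴ * V = 1 := by rw [hV, tensorPow_conjTranspose, tensorPow_mul, hUU, tensorPow_one]
  have hVV' : V * Vᴴ = 1 := by rw [hV, tensorPow_conjTranspose, tensorPow_mul, hUU', tensorPow_one]
  -- `s x` is the eigenvalue of `tangentPow 1 A n` at the product eigenvector with index `x`
  let s : (Fin n → d) → ℝ := fun x => ∑ i, e (x i)
  have hS : tangentPow 1 A n = V * Matrix.diagonal (fun x => (s x : ℂ)) * Vᴴ := by
    have : (fun x => (s x : ℂ)) = fun x : Fin n → d => ∑ i, (e (x i) : ℂ) := by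
      funext x; simp [s]
    rw [this, ← tangentPow_one_diagonal fun c => (e c : ℂ), hV, tensorPow_conjTranspose, tensorPow_mul_tangentPow,
      tangentPow_mul_tensorPow, mul_one, hUU', ← hspec]
  have htr : ∀ w : (Fin n → d) → ℝ,
      (tensorPow ρ n * (V * Matrix.diagonal (fun x => (w x : ℂ)) * Vᴴ)).trace.re =
        ∑ x, (∏ i, p (x i)) * w x := fun w => by
    have : (tensorPow ρ n * (V * Matrix.diagonal (fun x => (w x : ℂ)) * Vᴴ)).trace =
        (tensorPow (Uᴴ * ρ * U) n * Matrix.diagonal (fun x => (w x : ℂ))).trace := by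
      rw [← tensorPow_mul, ← tensorPow_mul, ← tensorPow_conjTranspose, ← hV, ← Matrix.mul_assoc,
        Matrix.trace_mul_comm]
      simp only [Matrix.mul_assoc]
    rw [this]
    simp only [Matrix.trace, Matrix.diag_apply, Matrix.mul_diagonal, tensorPow, tensorProd,
      Matrix.of_apply, hpC]
    norm_cast
  let X := V * Matrix.diagonal (fun x => (clip a (s x) : ℂ)) * Vᴴ
  refine ⟨X, ?_, ?_, ?_⟩
  · refine Matrix.isHermitian_mul_mul_conjTranspose V ?_
    rw [Matrix.IsHermitian, Matrix.diagonal_conjTranspose]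
    congr 1
    funext x
    simp
  · have hVu : V ∈ unitary (Matrix (Fin n → d) (Fin n → d) ℂ) := ⟨hVV, hVV'⟩
    have h1 : ‖X‖ = ‖Matrix.diagonal (fun x => (clip a (s x) : ℂ))‖ := by
      rw [show X = V * Matrix.diagonal (fun x => (clip a (s x) : ℂ)) * star V from rfl,
        CStarRing.norm_mul_mem_unitary _ (Unitary.star_mem hVu),
        CStarRing.norm_mem_unitary_mul _ hVu]
    rw [h1, Matrix.l2_opNorm_diagonal, pi_norm_le_iff_of_nonneg ha.le]
    intro x
    rw [Complex.norm_real]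
    exact abs_clip_le ha _
  · have hD : (tangentPow 1 A n - X) * (tangentPow 1 A n - X) =
        V * Matrix.diagonal (fun x => (((s x - clip a (s x)) ^ 2 : ℝ) : ℂ)) * Vᴴ := by
      have : tangentPow 1 A n - X =
          V * Matrix.diagonal (fun x => ((s x - clip a (s x) : ℝ) : ℂ)) * Vᴴ := by
        rw [hS, ← Matrix.sub_mul, ← Matrix.mul_sub, Matrix.diagonal_sub]
        simp
      rw [this]
      calc _ = V * Matrix.diagonal (fun x => ((s x - clip a (s x) : ℝ) : ℂ)) * (Vᴴ * V) *
            Matrix.diagonal (fun x => ((s x - clip a (s x) : ℝ) : ℂ)) * Vᴴ := by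
            simp only [Matrix.mul_assoc]
        _ = _ := by
            rw [hVV, mul_one, Matrix.mul_assoc V, Matrix.diagonal_mul_diagonal]
            simp [sq]
    rw [hD, htr]
    calc ∑ x, (∏ i, p (x i)) * (s x - clip a (s x)) ^ 2
        ≤ ∑ x, (∏ i, p (x i)) * (s x ^ 4 / a ^ 2) :=
          Finset.sum_le_sum fun x _ => mul_le_mul_of_nonneg_left (sub_clip_sq_le ha _)
            (Finset.prod_nonneg fun i _ => hp0 _)
      _ = sumMoment p e n 4 / a ^ 2 := by
          simp only [sumMoment, Finset.sum_div, mul_div_assoc, s]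
      _ ≤ _ := by
          gcongr
          exact sumMoment_four_le hp0 hp1 hpe n

theorem re_trace_mul_conjTranspose_mul_self_nonneg {m : Type*} [Fintype m]
    {σ : Matrix m m ℂ} (hσ : σ.PosSemidef) (Y : Matrix m m ℂ) :
    0 ≤ (σ * (Yᴴ * Y)).trace.re := by
  have h := (hσ.mul_mul_conjTranspose_same Y).trace_nonneg
  rw [Matrix.mul_assoc, Matrix.trace_mul_comm, Matrix.mul_assoc] at h
  exact (Complex.nonneg_iff.mp h).1

/-- Truncation for a general `L`, applied to its real and imaginary parts. -/
theorem exists_truncation {d : Type*} [Fintype d] [DecidableEq d]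
    {ρ L : Matrix d d ℂ} (hρ : IsDensity ρ) (h0 : (ρ * L).trace = 0) :
    ∃ K : ℝ, 0 ≤ K ∧ ∀ (n : ℕ) (a : ℝ), 0 < a →
      ∃ X : Matrix (Fin n → d) (Fin n → d) ℂ, ‖X‖ ≤ a ∧
        (tensorPow ρ n * ((tangentPow 1 L n - X)ᴴ * (tangentPow 1 L n - X))).trace.re ≤
          K * (n : ℝ) ^ 2 / a ^ 2 := by
  set A : Matrix d d ℂ := (realPart L : Matrix d d ℂ)
  set B : Matrix d d ℂ := (imaginaryPart L : Matrix d d ℂ)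
  have hAh : A.IsHermitian := (realPart L).2
  have hBh : B.IsHermitian := (imaginaryPart L).2
  have hL : L = A + Complex.I • B := (realPart_add_I_smul_imaginaryPart L).symm
  have hre : ∀ {C : Matrix d d ℂ}, C.IsHermitian → (ρ * C).trace.im = 0 := fun {C} hC => by
    have h : star (ρ * C).trace = (ρ * C).trace := by
      rw [← Matrix.trace_conjTranspose, Matrix.conjTranspose_mul, hC.eq, hρ.1.1.eq,
        Matrix.trace_mul_comm]
    exact Complex.conj_eq_iff_im.mp h
  have hsum : (ρ * A).trace + Complex.I * (ρ * B).trace = 0 := by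
    rw [← h0, hL, Matrix.mul_add, Matrix.trace_add, Matrix.mul_smul, Matrix.trace_smul,
      smul_eq_mul]
  have hA0 : (ρ * A).trace = 0 := by
    refine Complex.ext ?_ (hre hAh)
    simpa [hre hBh] using congrArg Complex.re hsum
  have hB0 : (ρ * B).trace = 0 := by simpa [hA0] using hsum
  obtain ⟨K₁, hK₁, h₁⟩ := exists_truncation_of_isHermitian hρ hAh hA0
  obtain ⟨K₂, hK₂, h₂⟩ := exists_truncation_of_isHermitian hρ hBh hB0
  refine ⟨8 * (K₁ + K₂), by positivity, fun n a ha => ?_⟩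
  obtain ⟨X, hXh, hXn, hX⟩ := h₁ n (a / 2) (by positivity)
  obtain ⟨Y, hYh, hYn, hY⟩ := h₂ n (a / 2) (by positivity)
  refine ⟨X + Complex.I • Y, ?_, ?_⟩
  · refine (norm_add_le _ _).trans ?_
    rw [norm_smul, Complex.norm_I, one_mul]
    linarith
  set P := tangentPow 1 A n - X with hP
  set Q := tangentPow 1 B n - Y with hQ
  have hSh : ∀ {C : Matrix d d ℂ}, C.IsHermitian → (tangentPow 1 C n).IsHermitian :=
    fun {C} hC => by
      rw [Matrix.IsHermitian, tangentPow_conjTranspose, hC.eq, Matrix.conjTranspose_one]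
  have hPh : Pᴴ = P := ((hSh hAh).sub hXh).eq
  have hQh : Qᴴ = Q := ((hSh hBh).sub hYh).eq
  have hPQ : tangentPow 1 L n - (X + Complex.I • Y) = P + Complex.I • Q := by
    rw [hL, tangentPow_add, tangentPow_smul, hP, hQ, smul_sub]
    abel
  -- parallelogram law: the square of `P + iQ` plus that of `P - iQ` is `2 P² + 2 Q²`
  have hpos := re_trace_mul_conjTranspose_mul_self_nonneg
    (tensorPow_posSemidef (n := n) hρ.1) (P - Complex.I • Q)
  have hpar : (P + Complex.I • Q)ᴴ * (P + Complex.I • Q) +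
      (P - Complex.I • Q)ᴴ * (P - Complex.I • Q) = ((2 : ℝ) : ℂ) • (P * P) + ((2 : ℝ) : ℂ) • (Q * Q) := by
    simp only [Matrix.conjTranspose_add, Matrix.conjTranspose_sub, Matrix.conjTranspose_smul,
      hPh, hQh, add_mul, mul_add, sub_mul, mul_sub, Matrix.smul_mul, Matrix.mul_smul, smul_smul,
      Complex.ofReal_ofNat, two_smul]
    simp
    abel
  have hpar' : (tensorPow ρ n * ((P + Complex.I • Q)ᴴ * (P + Complex.I • Q))).trace.re +
      (tensorPow ρ n * ((P - Complex.I • Q)ᴴ * (P - Complex.I • Q))).trace.re =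
        2 * (tensorPow ρ n * (P * P)).trace.re + 2 * (tensorPow ρ n * (Q * Q)).trace.re := by
    rw [← Complex.add_re, ← Matrix.trace_add, ← Matrix.mul_add, hpar]
    simp only [Matrix.mul_add, Matrix.trace_add, Complex.add_re, Matrix.mul_smul,
      Matrix.trace_smul, smul_eq_mul, Complex.re_ofReal_mul]
  rw [hPQ]
  have : 8 * (K₁ + K₂) * (n : ℝ) ^ 2 / a ^ 2 =
      2 * (K₁ * (n : ℝ) ^ 2 / (a / 2) ^ 2) + 2 * (K₂ * (n : ℝ) ^ 2 / (a / 2) ^ 2) := by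
    field_simp
    ring
  rw [this]
  linarith

/-! ### Variational lower bounds -/

variable {m : Type*} [Fintype m]

/-- Completing the square: the quadratic functional of `X` on the left attains its maximum,
the SLD Fisher information, at `X = L`. -/
theorem IsSLD.re_trace_mul {σ η L : Matrix m m ℂ} (hL : IsSLD σ η L) (X : Matrix m m ℂ) :
    2 * (η * X).trace.re - (σ * (X * X)).trace.re =
      (σ * (L * L)).trace.re - (σ * ((L - X) * (L - X))).trace.re := by
  have h : (η * X).trace = (1 / 2 : ℂ) * ((σ * (X * L)).trace + (σ * (L * X)).trace) := by
    rw [hL.2, Matrix.smul_mul, Matrix.trace_smul, smul_eq_mul, add_mul, Matrix.trace_add,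
      Matrix.mul_assoc, Matrix.trace_mul_comm L, Matrix.mul_assoc, Matrix.mul_assoc]
  have h' : ((2 : ℝ) : ℂ) * (η * X).trace = (σ * (X * L)).trace + (σ * (L * X)).trace := by
    rw [h]; push_cast; ring
  have h'' := congrArg Complex.re h'
  simp only [Complex.re_ofReal_mul, Complex.add_re] at h''
  rw [h'']
  simp only [sub_mul, mul_sub, Matrix.trace_sub, Complex.sub_re]
  ring

/-- Completing the square: the quadratic functional of `X` on the left attains its maximum,
the RLD Fisher information, at `X = L`. -/
theorem IsRLD.re_trace_mul {σ η L : Matrix m m ℂ} (hσ : σ.IsHermitian) (hL : IsRLD σ η L)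
    (X : Matrix m m ℂ) :
    2 * (η * Xᴴ).trace.re - (σ * (Xᴴ * X)).trace.re =
      (σ * (Lᴴ * L)).trace.re - (σ * ((L - X)ᴴ * (L - X))).trace.re := by
  have h1 : (η * Xᴴ).trace = (σ * (Xᴴ * L)).trace := by
    rw [show η = L * σ from hL, Matrix.mul_assoc, Matrix.trace_mul_comm, Matrix.mul_assoc]
  have h2 : (σ * (Lᴴ * X)).trace = star (σ * (Xᴴ * L)).trace := by
    rw [← Matrix.trace_conjTranspose, Matrix.conjTranspose_mul, Matrix.conjTranspose_mul,
      Matrix.conjTranspose_conjTranspose, hσ.eq, Matrix.trace_mul_comm]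
  have h3 : (σ * (Lᴴ * X)).trace.re = (σ * (Xᴴ * L)).trace.re := by
    rw [h2]; simp
  simp only [Matrix.conjTranspose_sub, sub_mul, mul_sub, Matrix.trace_sub, Complex.sub_re, h3, h1]
  ring

theorem le_sldFisher {σ η X : Matrix m m ℂ} (hσ : σ.PosSemidef) (hX : X.IsHermitian) :
    ((2 * (η * X).trace.re - (σ * (X * X)).trace.re : ℝ) : EReal) ≤ sldFisher σ η := by
  refine le_iInf₂ fun L hL => EReal.coe_le_coe_iff.mpr ?_
  rw [hL.re_trace_mul X]
  have := re_trace_mul_conjTranspose_mul_self_nonneg hσ (L - X)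
  rw [(hL.1.sub hX).eq] at this
  linarith

theorem le_rldFisher {σ η : Matrix m m ℂ} (hσ : σ.PosSemidef) (X : Matrix m m ℂ) :
    ((2 * (η * Xᴴ).trace.re - (σ * (Xᴴ * X)).trace.re : ℝ) : EReal) ≤ rldFisher σ η := by
  refine le_iInf₂ fun L hL => EReal.coe_le_coe_iff.mpr ?_
  rw [hL.re_trace_mul hσ.1 X]
  have := re_trace_mul_conjTranspose_mul_self_nonneg hσ (L - X)
  linarith

variable [DecidableEq m]

theorem re_trace_mul_sub_le {M N X : Matrix m m ℂ} {a : ℝ} (hX : ‖X‖ ≤ a) :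
    |(M * X).trace.re - (N * X).trace.re| ≤ a * traceNorm (M - N) := by
  rw [← Complex.sub_re, ← Matrix.trace_sub, ← Matrix.sub_mul]
  refine (Complex.abs_re_le_norm _).trans ((norm_trace_mul_le _ _).trans ?_)
  exact mul_le_mul_of_nonneg_right hX (Finset.sum_nonneg fun _ _ => Real.sqrt_nonneg _)

/-- A Hermitian `X` of small operator norm that is close to the SLD of `(σ, η)` in mean square
gives a lower bound of the SLD Fisher information at every nearby pair `(σ', η')`. -/
theorem le_sldFisher_of_near {σ η σ' η' S X : Matrix m m ℂ} {a b : ℝ}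
    (hS : IsSLD σ η S) (hσ' : σ'.PosSemidef) (hX : X.IsHermitian)
    (hXa : ‖X‖ ≤ a) (hb : (σ * ((S - X) * (S - X))).trace.re ≤ b) :
    (((σ * (S * S)).trace.re -
      (2 * a * traceNorm (η' - η) + a ^ 2 * traceNorm (σ' - σ) + b) : ℝ) : EReal) ≤
      sldFisher σ' η' := by
  refine le_trans (EReal.coe_le_coe_iff.mpr ?_) (le_sldFisher hσ' hX)
  have h1 := (abs_le.mp (re_trace_mul_sub_le (M := η') (N := η) hXa)).1
  have hXX : ‖X * X‖ ≤ a ^ 2 := (norm_mul_le _ _).trans (by nlinarith [norm_nonneg X])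
  have h2 := (abs_le.mp (re_trace_mul_sub_le (M := σ') (N := σ) hXX)).2
  have h3 := hS.re_trace_mul X
  linarith

/-- An `X` of small operator norm that is close to the RLD of `(σ, η)` in mean square gives a
lower bound of the RLD Fisher information at every nearby pair `(σ', η')`. -/
theorem le_rldFisher_of_near {σ η σ' η' S X : Matrix m m ℂ} {a b : ℝ}
    (hσ : σ.IsHermitian) (hS : IsRLD σ η S) (hσ' : σ'.PosSemidef)
    (hXa : ‖X‖ ≤ a) (hb : (σ * ((S - X)ᴴ * (S - X))).trace.re ≤ b) :
    (((σ * (Sᴴ * S)).trace.re -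
      (2 * a * traceNorm (η' - η) + a ^ 2 * traceNorm (σ' - σ) + b) : ℝ) : EReal) ≤
      rldFisher σ' η' := by
  refine le_trans (EReal.coe_le_coe_iff.mpr ?_) (le_rldFisher hσ' X)
  have hXa' : ‖Xᴴ‖ ≤ a := (Matrix.l2_opNorm_conjTranspose X).trans_le hXa
  have h1 := (abs_le.mp (re_trace_mul_sub_le (M := η') (N := η) hXa')).1
  have hXX : ‖Xᴴ * X‖ ≤ a ^ 2 :=
    (norm_mul_le _ _).trans (by nlinarith [norm_nonneg X, norm_nonneg Xᴴ])
  have h2 := (abs_le.mp (re_trace_mul_sub_le (M := σ') (N := σ) hXX)).2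
  have h3 := hS.re_trace_mul hσ X
  linarith

end Truncation

/-! ### Passage to the limit -/

/-- With `a = C √n`, the bound `hF` divided by `n` has an error tending to `K / C ^ 2`, and `C`
is arbitrary. -/
theorem liminf_nonneg_of_lower_bound {F G : ℕ → EReal} {g s t : ℕ → ℝ} {K : ℝ} (hK : 0 ≤ K)
    (hs : Filter.Tendsto s Filter.atTop (nhds 0))
    (ht : Filter.Tendsto (fun n : ℕ => (1 / √(n : ℝ)) * t n) Filter.atTop (nhds 0))
    (hG : ∀ n, G n = (g n : EReal))
    (hF : ∀ (n : ℕ) (a : ℝ), 0 < a →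
      ((g n - (2 * a * t n + a ^ 2 * s n + K * (n : ℝ) ^ 2 / a ^ 2) : ℝ) : EReal) ≤ F n) :
    0 ≤ Filter.liminf (fun n : ℕ => (((1 / (n : ℝ)) : ℝ) : EReal) * (F n - G n))
      Filter.atTop := by
  refine le_of_forall_lt_imp_le_of_dense fun c hc => ?_
  obtain ⟨r, hcr, hr⟩ := EReal.lt_iff_exists_real_btwn.mp hc
  have hr0 : r < 0 := by exact_mod_cast hr
  -- the truncation level is `C √n`, with `C` so large that the truncation error is below `-r / 2`
  obtain ⟨C, hC0, hC⟩ : ∃ C : ℝ, 0 < C ∧ K / C ^ 2 ≤ -r / 2 := by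
    refine ⟨√((K + 1) / (-r / 2)), Real.sqrt_pos.mpr (div_pos (by linarith) (by linarith)), ?_⟩
    rw [Real.sq_sqrt (div_nonneg (by linarith) (by linarith)), div_div_eq_mul_div,
      div_le_iff₀ (by linarith)]
    nlinarith
  have hlim : Filter.Tendsto
      (fun n : ℕ => 2 * C * ((1 / √(n : ℝ)) * t n) + C ^ 2 * s n) Filter.atTop (nhds 0) := by
    simpa using (ht.const_mul (2 * C)).add (hs.const_mul (C ^ 2))
  refine hcr.le.trans (Filter.le_liminf_of_le (by isBoundedDefault) ?_)
  filter_upwards [hlim.eventually_lt_const (show (0 : ℝ) < -r / 2 by linarith),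
    Filter.eventually_ge_atTop 1] with n hn hn1
  have hnpos : (0 : ℝ) < n := by exact_mod_cast hn1
  have hsq : √(n : ℝ) * √(n : ℝ) = n := Real.mul_self_sqrt hnpos.le
  have hspos : 0 < √(n : ℝ) := Real.sqrt_pos.mpr hnpos
  have hF' := hF n (C * √(n : ℝ)) (by positivity)
  rw [hG]
  set E := 2 * (C * √(n : ℝ)) * t n + (C * √(n : ℝ)) ^ 2 * s n +
    K * (n : ℝ) ^ 2 / (C * √(n : ℝ)) ^ 2 with hE
  have hEn : E = n * (2 * C * ((1 / √(n : ℝ)) * t n) + C ^ 2 * s n + K / C ^ 2) := by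
    have h1 : (C * √(n : ℝ)) ^ 2 = C ^ 2 * n := by rw [mul_pow, sq (√(n : ℝ)), hsq]
    have h2 : (n : ℝ) * (1 / √(n : ℝ)) = √(n : ℝ) := by
      rw [mul_one_div, div_eq_iff hspos.ne', hsq]
    have h3 : K * (n : ℝ) ^ 2 / (C ^ 2 * n) = n * (K / C ^ 2) := by field_simp
    rw [hE, h1, h3]
    linear_combination (-(2 * C * t n)) * h2
  have hEr : n * r ≤ -E := by
    rw [hEn]
    nlinarith
  induction hf : F n with
  | bot => rw [hf] at hF'; exact absurd (le_bot_iff.mp hF') (EReal.coe_ne_bot _)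
  | top =>
    rw [EReal.top_sub_coe, EReal.coe_mul_top_of_pos (by positivity)]
    exact le_top
  | coe f =>
    rw [hf, EReal.coe_le_coe_iff] at hF'
    rw [← EReal.coe_sub, ← EReal.coe_mul, EReal.coe_le_coe_iff, one_div, ← div_eq_inv_mul,
      le_div_iff₀ hnpos]
    linarith

end QFisher

theorem mainTheorem10 {d : Type*} [Fintype d] [DecidableEq d]
    (ρ δ : Matrix d d ℂ) (hρ : QFisher.IsDensity ρ) (hδ : QFisher.IsTangent δ)
    (ρ' δ' : (n : ℕ) → Matrix (Fin n → d) (Fin n → d) ℂ)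
    (hρ' : ∀ n, QFisher.IsDensity (ρ' n)) (hδ' : ∀ n, QFisher.IsTangent (δ' n))
    (hρlim : Filter.Tendsto (fun n : ℕ => QFisher.traceNorm (ρ' n - QFisher.tensorPow ρ n))
      Filter.atTop (nhds 0))
    (hδlim : Filter.Tendsto
      (fun n : ℕ => (1 / √(n : ℝ)) * QFisher.traceNorm (δ' n - QFisher.tangentPow ρ δ n))
      Filter.atTop (nhds 0)) :
    (QFisher.sldFisher ρ δ ≠ ⊤ →
      0 ≤ Filter.liminf (fun n : ℕ => (((1 / (n : ℝ)) : ℝ) : EReal) *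
        (QFisher.sldFisher (ρ' n) (δ' n) -
          QFisher.sldFisher (QFisher.tensorPow ρ n) (QFisher.tangentPow ρ δ n)))
        Filter.atTop) ∧
    (QFisher.rldFisher ρ δ ≠ ⊤ →
      0 ≤ Filter.liminf (fun n : ℕ => (((1 / (n : ℝ)) : ℝ) : EReal) *
        (QFisher.rldFisher (ρ' n) (δ' n) -
          QFisher.rldFisher (QFisher.tensorPow ρ n) (QFisher.tangentPow ρ δ n)))
        Filter.atTop) := by
  have hσ : ∀ n, (QFisher.tensorPow ρ n).IsHermitian := fun n =>
    (QFisher.tensorPow_posSemidef hρ.1).1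
  refine ⟨fun hJ => ?_, fun hJ => ?_⟩
  · obtain ⟨L, hL⟩ : ∃ L, QFisher.IsSLD ρ δ L := by
      by_contra! h
      exact hJ (by simp [QFisher.sldFisher, h])
    have h0 : (ρ * L).trace = 0 := by
      rw [← hδ.2, hL.2, Matrix.trace_smul, Matrix.trace_add, Matrix.trace_mul_comm L, smul_eq_mul]
      ring
    obtain ⟨K, hK, htrunc⟩ := QFisher.exists_truncation_of_isHermitian hρ hL.1 h0
    refine QFisher.liminf_nonneg_of_lower_bound hK hρlim hδlim
      (fun n => QFisher.sldFisher_eq hL.tensor) fun n a ha => ?_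
    obtain ⟨X, hXh, hXa, hX⟩ := htrunc n a ha
    exact QFisher.le_sldFisher_of_near hL.tensor (hρ' n).1 hXh hXa hX
  · obtain ⟨L, hL⟩ : ∃ L, QFisher.IsRLD ρ δ L := by
      by_contra! h
      exact hJ (by simp [QFisher.rldFisher, h])
    have h0 : (ρ * L).trace = 0 := by
      rw [Matrix.trace_mul_comm, ← show δ = L * ρ from hL, hδ.2]
    obtain ⟨K, hK, htrunc⟩ := QFisher.exists_truncation hρ h0
    refine QFisher.liminf_nonneg_of_lower_bound hK hρlim hδlim
      (fun n => QFisher.rldFisher_eq (hσ n) hL.tensor) fun n a ha => ?_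
    obtain ⟨X, hXa, hX⟩ := htrunc n a ha
    exact QFisher.le_rldFisher_of_near (hσ n) hL.tensor (hρ' n).1 hXa hX
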